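/- **Theorem.** Let $N$ agents with positions $\xi_i(t)\in\mathbb R^d$ obey, for almost all $t\ge 0$, $$\dot\xi_i(t)=\sum_{j=1}^N a_{ij}(t)\,(\xi_j(t)-\xi_i(t))+a_{i0}(t)\,(\omega_i(t)-\xi_i(t)),\qquad i=1,\dots,N,$$ where the $\xi_i$ are locally absolutely continuous on $[0,\infty)$, $\Omega\subseteq\mathbb R^d$ is a nonempty closed convex set, and $\omega_i(t)\in\Omega$ whenever $a_{i0}(t)>0$ ($\omega_i(t)$ is arbitrary otherwise). Let $\hat A(t)=(a_{ij}(t))_{i,j=0}^N$ be the extended matrix, with $a_{0j}\equiv 0$ for all $j$, and $A(t)=(a_{ij}(t))_{i,j=1}^N$. Assume that all entries of $\hat A$ are measurable, nonnegative and bounded on $[0,\infty)$. Put $x_i(t)=\tfrac12\,\mathrm{dist}(\xi_i(t),\Omega)^2$. For a nonnegative matrix $M=(m_{ij})$ let $G[M]$ be the directed graph on its indices with an arc from $j$ to $i$ iff $m_{ij}>0$. Suppose that one of the following conditions holds. 1. The graph $G[\hat A(t)]$ is *uniformly quasi-strongly connected*: there are $T>0$ and $\delta>0$ such that for every $t\ge0$,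 after the entries smaller than $\delta$ of the matrix $\int_t^{t+T}\hat A(s)\,ds$ are replaced by $0$, the graph of the resulting matrix has a root node from which all its nodes are reachable by directed walks. 2. The graph $G[A(t)]$ is *cut-balanced*: there is $K\ge1$ such that for all $S\subseteq\{1,\dots,N\}$ and $t\ge0$, $$K^{-1}\sum_{j\in S}\sum_{k\notin S}a_{kj}(t)\le\sum_{j\in S}\sum_{k\notin S}a_{jk}(t)\le K\sum_{j\in S}\sum_{k\notin S}a_{kj}(t);$$ it is *infinitely strongly connected* (ISC): the directed graph on $\{1,\dots,N\}$ with the arcs $(i,j)$ such that $\int_0^\infty a_{ji}(t)\,dt=\infty$ is strongly connected; and $\sum_{i=1}^N\int_0^\infty a_{i0}(t)\,dt=\infty$. Then the agents converge to $\Omega$: $x_i(t)\to0$ as $t\to\infty$ for every $i$ (equivalently, $\mathrm{dist}(\xi_i(t),\Omega)\to 0$). In case 1 the convergence is exponential: there are constants $C,\alpha>0$, depending only on $\hat A(\cdot)$, such that for all $d$, $\Omega$, $\omega_i$ and $\xi_i$ as above, $$x_i(t)\le C e^{-\alpha t}\max_j x_j(0)\qquad\text{for all } t\ge 0 \text{ and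 all } i.$$ -/

import Mathlib

open MeasureTheory Filter Topology

namespace TargetAggregation

noncomputable section

/-! ### Weighted directed graphs -/

/-- The directed graph `G[A]` of a matrix `A = (a_ij)`: there is an arc from `j` to `i` exactly
when `a_ij > 0`. -/
def graphOf {V : Type*} (A : Matrix V V ℝ) : Digraph V where
  Adj j i := 0 < A i j

/-- `j` is reachable from `i` by a (possibly trivial) directed walk. -/
def Reachable {V : Type*} (G : Digraph V) (i j : V) : Prop :=
  Relation.ReflTransGen G.Adj i j

/-- Every node is reachable from every node. -/
def StronglyConnected {V : Type*} (G : Digraph V) : Prop :=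
  ∀ i j : V, Reachable G i j

/-- There is a root node from which every node is reachable. -/
def QuasiStronglyConnected {V : Type*} (G : Digraph V) : Prop :=
  ∃ r : V, ∀ i : V, Reachable G r i

open Classical in
/-- The truncation `A^δ`: entries smaller than `δ` are replaced by zero. -/
def truncation {V : Type*} (δ : ℝ) (A : Matrix V V ℝ) : Matrix V V ℝ :=
  Matrix.of fun i j => if δ ≤ A i j then A i j else 0

/-- `G[A]` is quasi-strongly `δ`-connected. -/
def QuasiStronglyDeltaConnected {V : Type*} (δ : ℝ) (A : Matrix V V ℝ) : Prop :=
  QuasiStronglyConnected (graphOf (truncation δ A))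

/-! ### Time-varying weighted graphs on the time axis `[0, ∞)` -/

/-- The adjacency matrix `∫_Δ A(s) ds` of the union of the graphs `G[A(s)]` over `s ∈ Δ`. -/
def unionMatrix {V : Type*} (A : ℝ → Matrix V V ℝ) (Δ : Set ℝ) : Matrix V V ℝ :=
  Matrix.of fun i j => ∫ s in Δ, A s i j

/-- Uniform quasi-strong connectivity: for some `T, δ > 0` all unions of the graph over the windows
`[t, t + T]`, `t ≥ 0`, are quasi-strongly `δ`-connected. -/
def UniformlyQuasiStronglyConnected {V : Type*} (A : ℝ → Matrix V V ℝ) : Prop :=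
  ∃ T > 0, ∃ δ > 0, ∀ t ≥ 0,
    QuasiStronglyDeltaConnected δ (unionMatrix A (Set.Icc t (t + T)))

/-- The value in `[0, ∞]` of `∫_0^∞ f(t) dt`, for a function `f` that is nonnegative on
`[0, ∞)`. -/
def totalIntegral (f : ℝ → ℝ) : ENNReal :=
  ∫⁻ t in Set.Ici (0 : ℝ), ENNReal.ofReal (f t)

/-- Infinite strong connectivity (ISC): the graph with the arcs `(i, j)` such that
`∫_0^∞ a_ji(t) dt = ∞` is strongly connected. -/
def InfinitelyStronglyConnected {V : Type*} (A : ℝ → Matrix V V ℝ) : Prop :=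
  StronglyConnected
    ({ Adj := fun i j => totalIntegral (fun t => A t j i) = ⊤ } : Digraph V)

/-- Cut balance: for some `K ≥ 1`, at any time, the flows into and out of any set of nodes `S`
differ at most by the factor `K`. -/
def CutBalanced {V : Type*} [Fintype V] [DecidableEq V] (A : ℝ → Matrix V V ℝ) : Prop :=
  ∃ K : ℝ, 1 ≤ K ∧ ∀ S : Finset V, ∀ t ≥ (0 : ℝ),
    K⁻¹ * (∑ j ∈ S, ∑ k ∈ Sᶜ, A t k j) ≤ ∑ j ∈ S, ∑ k ∈ Sᶜ, A t j k ∧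
    ∑ j ∈ S, ∑ k ∈ Sᶜ, A t j k ≤ K * (∑ j ∈ S, ∑ k ∈ Sᶜ, A t k j)

/-- The entries are admissible weights on `[0, ∞)`: measurable, nonnegative and bounded. -/
structure BoundedWeights {V : Type*} (A : ℝ → Matrix V V ℝ) : Prop where
  aemeasurable : ∀ i j, AEMeasurable (fun t => A t i j) (volume.restrict (Set.Ici (0 : ℝ)))
  nonneg : ∀ i j, ∀ t ≥ (0 : ℝ), 0 ≤ A t i j
  bounded : ∃ C : ℝ, ∀ i j, ∀ t ≥ (0 : ℝ), A t i j ≤ C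

/-! ### The target aggregation protocol -/

/-- The extended matrix `Â(t)` on the agents `some i` and the virtual target node `none`
(usually numbered `0`): its block on the agents is `A(t)`, the target influences agent `i` with the
weight `a_i0(t) = a₀ t i`, and nothing influences the target. -/
def extendedMatrix {V : Type*} (A : ℝ → Matrix V V ℝ) (a₀ : ℝ → V → ℝ) :
    ℝ → Matrix (Option V) (Option V) ℝ :=
  fun t => Matrix.of fun i j =>
    match i, j with
    | none, _ => 0
    | some i, none => a₀ t i
    | some i, some j => A t i j

/-- `ξ` is a trajectory on `[0, ∞)` of the protocol
`ξ̇_i = ∑_j a_ij (ξ_j - ξ_i) + a_i0 (ω_i - ξ_i)` with target set `Ω`; the point `ω_i(t)` lies in `Ω`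
whenever agent `i` is informed at time `t`, i.e. `a_i0(t) > 0`, and is arbitrary otherwise.
Solutions are locally absolutely continuous and satisfy the equations for almost all `t ≥ 0`. -/
structure IsTrajectory {N d : ℕ} (A : ℝ → Matrix (Fin N) (Fin N) ℝ) (a₀ : ℝ → Fin N → ℝ)
    (Ω : Set (EuclideanSpace ℝ (Fin d))) (ω ξ : ℝ → Fin N → EuclideanSpace ℝ (Fin d)) : Prop where
  informed : ∀ i, ∀ t ≥ (0 : ℝ), 0 < a₀ t i → ω t i ∈ Ω
  absolutelyContinuous : ∀ i, ∀ T ≥ (0 : ℝ), AbsolutelyContinuousOnInterval (fun t => ξ t i) 0 T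
  equation : ∀ᵐ t ∂(volume.restrict (Set.Ici (0 : ℝ))), ∀ i,
    HasDerivAt (fun s => ξ s i)
      (∑ j, A t i j • (ξ t j - ξ t i) + a₀ t i • (ω t i - ξ t i)) t

/-- `½ d_Ω(p)²`, where `d_Ω(p)` is the Euclidean distance from `p` to `Ω`. -/
def halfSqDist {d : ℕ} (Ω : Set (EuclideanSpace ℝ (Fin d))) (p : EuclideanSpace ℝ (Fin d)) : ℝ :=
  (1 / 2) * Metric.infDist p Ω ^ 2

end

end TargetAggregation

open TargetAggregation

open TargetAggregation

/-! ### Absolutely continuous functions -/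

/-! The distance to a convex set is convex and 1-Lipschitz. Hence `y_i = dist(ξ_i, Ω)` satisfies,
almost everywhere, `y_i' ≤ ∑_j a_ij (y_j - y_i) - a_i0 y_i`: a scalar subsolution over the extended
graph, with value 0 at the target (`IsTrajectory.isSubsolution`). The space, `Ω` and `ω` play no
further role.

Uniform connectivity. If all `y_i ≤ M` at some time, then `z = M - y` is a nonnegative supersolution
from then on, and `z = M` at the target, which must be the root of every window. A component of `z`
loses at most an exponential factor over a window, and a node influenced with integrated weight at
least `δ` inherits a fixed share of its neighbour's value. So each window adds a node to the set
where `z` is not small (`IsSupersolution.card_window`). After as many windows as nodes, `z` is at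
least a fixed fraction of `M` everywhere, that is, `max y` has contracted by a factor depending on
the graph only.

Cut balance. The Lyapunov functions are the sums `∑_k w_k y_(k)` of the increasingly sorted values,
where each weight exceeds the smaller ones by the factor `K` of the cut balance. For a fixed order
the velocity is linear in `y`, and `y` is a positive combination of indicators of its superlevel
sets `S`. On such an indicator, the flow into `S` counts with a weight at least `K` times that of
the flow out of `S`, so the velocity is nonpositive (`weightedVelocity_le`). Enough such functions
exist to make every sorted value converge. If some limit were positive, then the agents with values
near the positive limits would form a constant set `S` with a gap to the others and to the target.
The dissipation would bound the total inflow of `S`, contradicting infinite connectivity or the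
infinite influence of the target (`not_eventually_separated`).

Minima and sorted sums are differentiated by touching: at a time of differentiability, their
derivative equals that of the component, or of the sum with frozen order, attaining them
(`HasDerivAt.eq_of_le_of_eq`). -/

/-- A function whose increments are dominated by those of finitely many absolutely continuous
functions is absolutely continuous. -/
theorem absolutelyContinuousOnInterval_of_dist_le {ι X Y : Type*} [Fintype ι]
    [PseudoMetricSpace X] [PseudoMetricSpace Y] {f : ι → ℝ → X} {g : ℝ → Y} {a b : ℝ} (K : ℝ)
    (hf : ∀ i, AbsolutelyContinuousOnInterval (f i) a b)
    (h : ∀ x y, dist (g x) (g y) ≤ K * ∑ i, dist (f i x) (f i y)) :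
    AbsolutelyContinuousOnInterval g a b := by
  have hsum : Tendsto (fun E : ℕ × (ℕ → ℝ × ℝ) => K * ∑ i, ∑ n ∈ Finset.range E.1,
      dist (f i (E.2 n).1) (f i (E.2 n).2))
      (AbsolutelyContinuousOnInterval.totalLengthFilter ⊓
        𝓟 (AbsolutelyContinuousOnInterval.disjWithin a b)) (𝓝 0) := by
    simpa using (tendsto_finsetSum Finset.univ fun i _ => hf i).const_mul K
  refine squeeze_zero (fun E => Finset.sum_nonneg fun i _ => dist_nonneg) (fun E => ?_) hsum
  rw [Finset.sum_comm, Finset.mul_sum]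
  exact Finset.sum_le_sum fun n _ => h _ _

/-- An absolutely continuous function grows at most by the integral of an almost everywhere bound
of its derivative. -/
theorem AbsolutelyContinuousOnInterval.sub_le_integral {f g : ℝ → ℝ} {a b : ℝ} (hab : a ≤ b)
    (hf : AbsolutelyContinuousOnInterval f a b) (hg : IntervalIntegrable g volume a b)
    (h : ∀ᵐ t, t ∈ Set.Icc a b → ∀ f', HasDerivAt f f' t → f' ≤ g t) :
    f b - f a ≤ ∫ t in a..b, g t := by
  rw [← hf.integral_deriv_eq_sub]
  refine intervalIntegral.integral_mono_ae_restrict hab hf.intervalIntegrable_deriv hg ?_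
  have hd := hf.ae_differentiableAt
  rw [Set.uIcc_of_le hab] at hd
  rw [Filter.EventuallyLE, ae_restrict_iff' measurableSet_Icc]
  filter_upwards [h, hd] with t h1 h2 ht
  exact h1 ht _ (h2 ht).hasDerivAt

/-- If `f` lies below `g` and touches it at `t`, then the derivatives at `t` agree. -/
theorem HasDerivAt.eq_of_le_of_eq {f g : ℝ → ℝ} {f' g' t : ℝ} (hf : HasDerivAt f f' t)
    (hg : HasDerivAt g g' t) (hle : ∀ s, f s ≤ g s) (heq : f t = g t) : f' = g' := by
  have hmin : IsLocalMin (fun s => g s - f s) t :=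
    Filter.Eventually.of_forall fun s => by simpa [heq] using hle s
  linarith [hmin.hasDerivAt_eq_zero (hg.sub hf)]

/-! ### Differential inequalities over a weighted graph -/

/-- `y` is a locally absolutely continuous solution on `[0, ∞)` of the differential inequalities
`y_i' ≤ ∑ j, a_ij (y_j - y_i)`. -/
structure IsSubsolution {V : Type*} [Fintype V] (A : ℝ → Matrix V V ℝ) (y : ℝ → V → ℝ) :
    Prop where
  absolutelyContinuous : ∀ i, ∀ T ≥ (0 : ℝ), AbsolutelyContinuousOnInterval (fun t => y t i) 0 T
  deriv_le : ∀ᵐ t, 0 ≤ t → ∀ i, ∃ y', HasDerivAt (fun s => y s i) y' t ∧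
    y' ≤ ∑ j, A t i j * (y t j - y t i)

/-- `z` is a locally absolutely continuous solution on `[0, ∞)` of the differential inequalities
`z_i' ≥ ∑ j, a_ij (z_j - z_i)`. -/
structure IsSupersolution {V : Type*} [Fintype V] (A : ℝ → Matrix V V ℝ) (z : ℝ → V → ℝ) :
    Prop where
  absolutelyContinuous : ∀ i, ∀ T ≥ (0 : ℝ), AbsolutelyContinuousOnInterval (fun t => z t i) 0 T
  le_deriv : ∀ᵐ t, 0 ≤ t → ∀ i, ∃ z', HasDerivAt (fun s => z s i) z' t ∧
    ∑ j, A t i j * (z t j - z t i) ≤ z'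

/-- The right-hand side involves only differences, so constants drop out. This turns upper bounds on
`y` into lower bounds on a nonnegative function. -/
theorem IsSubsolution.const_sub {V : Type*} [Fintype V] {A : ℝ → Matrix V V ℝ} {y : ℝ → V → ℝ}
    (hy : IsSubsolution A y) (M : ℝ) : IsSupersolution A fun t i => M - y t i where
  absolutelyContinuous i T hT :=
    absolutelyContinuousOnInterval_of_dist_le (ι := Unit) (f := fun _ t => y t i) 1
      (fun _ => hy.absolutelyContinuous i T hT) fun s t => by rw [dist_sub_left]; simp
  le_deriv := by
    filter_upwards [hy.deriv_le] with t ht h0 i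
    obtain ⟨y', hd, hle⟩ := ht h0 i
    refine ⟨-y', by simpa using hd.const_sub M, ?_⟩
    calc _ = -∑ j, A t i j * (y t j - y t i) := by
          rw [← Finset.sum_neg_distrib]; exact Finset.sum_congr rfl fun j _ => by ring
      _ ≤ -y' := neg_le_neg hle

theorem absolutelyContinuousOnInterval_of_nonneg {X : Type*} [PseudoMetricSpace X] {f : ℝ → X}
    (hf : ∀ T ≥ (0 : ℝ), AbsolutelyContinuousOnInterval f 0 T) {s t : ℝ} (hs : 0 ≤ s)
    (hst : s ≤ t) : AbsolutelyContinuousOnInterval f s t := by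
  refine (hf t (hs.trans hst)).mono ?_
  rw [Set.uIcc_of_le hst, Set.uIcc_of_le (hs.trans hst)]
  exact Set.Icc_subset_Icc_left hs

theorem TargetAggregation.BoundedWeights.intervalIntegrable {V : Type*} {A : ℝ → Matrix V V ℝ}
    (hA : BoundedWeights A) (i j : V) {s t : ℝ} (hs : 0 ≤ s) (hst : s ≤ t) :
    IntervalIntegrable (fun u => A u i j) volume s t := by
  obtain ⟨C, hC⟩ := hA.bounded
  have hsub : Set.Ioc s t ⊆ Set.Ici 0 := fun u hu => hs.trans hu.1.le
  rw [intervalIntegrable_iff_integrableOn_Ioc_of_le hst]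
  refine Integrable.of_bound
    ((hA.aemeasurable i j).mono_measure (Measure.restrict_mono hsub le_rfl)).aestronglyMeasurable C ?_
  refine (ae_restrict_iff' measurableSet_Ioc).2 (Filter.Eventually.of_forall fun u hu => ?_)
  rw [Real.norm_of_nonneg (hA.nonneg i j u (hsub hu))]
  exact hC i j u (hsub hu)

/-! ### The distances of the agents to the target set -/

/-- The distance to a convex set is a convex function: Jensen's inequality for the velocity of an
agent that moves towards points `q k`. -/
theorem infDist_add_smul_le {ι E : Type*} [Fintype ι] [NormedAddCommGroup E] [NormedSpace ℝ E]
    [ProperSpace E] {Ω : Set E} (hne : Ω.Nonempty) (hcl : IsClosed Ω) (hconv : Convex ℝ Ω)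
    (p : E) (c : ι → ℝ) (q : ι → E) (hc : ∀ k, 0 ≤ c k) (hsum : ∑ k, c k ≤ 1) :
    Metric.infDist (p + ∑ k, c k • (q k - p)) Ω ≤
      Metric.infDist p Ω + ∑ k, c k * (Metric.infDist (q k) Ω - Metric.infDist p Ω) := by
  obtain ⟨p', hp', hpd⟩ := hcl.exists_infDist_eq_dist hne p
  choose q' hq' hqd using fun k => hcl.exists_infDist_eq_dist hne (q k)
  -- The comparison point in `Ω` is the same convex combination, taken of the nearest points; `p'`
  -- carries the remaining weight.
  have hmem : (1 - ∑ k, c k) • p' + ∑ k, c k • q' k ∈ Ω := by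
    have := hconv.sum_mem (t := Finset.univ) (w := fun o : Option ι => o.elim (1 - ∑ k, c k) c)
      (z := fun o : Option ι => o.elim p' q')
      (by rintro (_ | k) - <;> simp [hc, hsum]) (by simp [Fintype.sum_option])
      (by rintro (_ | k) - <;> simp [hp', hq'])
    simpa [Fintype.sum_option] using this
  refine (Metric.infDist_le_dist_of_mem hmem).trans ?_
  have heq : p + ∑ k, c k • (q k - p) - ((1 - ∑ k, c k) • p' + ∑ k, c k • q' k) =
      (1 - ∑ k, c k) • (p - p') + ∑ k, c k • (q k - q' k) := by
    simp only [smul_sub, Finset.sum_sub_distrib, sub_smul, ← Finset.sum_smul, one_smul]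
    abel
  rw [dist_eq_norm, heq]
  refine (norm_add_le _ _).trans ?_
  have h1 : ‖(1 - ∑ k, c k) • (p - p')‖ = (1 - ∑ k, c k) * Metric.infDist p Ω := by
    rw [norm_smul, Real.norm_of_nonneg (by linarith), hpd, dist_eq_norm]
  have h2 : ‖∑ k, c k • (q k - q' k)‖ ≤ ∑ k, c k * Metric.infDist (q k) Ω := by
    refine (norm_sum_le _ _).trans (Finset.sum_le_sum fun k _ => ?_)
    rw [norm_smul, Real.norm_of_nonneg (hc k), hqd, dist_eq_norm]
  simp only [mul_sub, Finset.sum_sub_distrib, ← Finset.sum_mul]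
  linarith

/-- The derivative of a function that grows at most linearly with slope `B` to the right of `0`. -/
theorem HasDerivAt.le_of_eventually_le {g : ℝ → ℝ} {d B : ℝ} (hg : HasDerivAt g d 0)
    (h : ∀ᶠ s in 𝓝[>] (0 : ℝ), g s ≤ g 0 + s * B) : d ≤ B := by
  have ht := hg.tendsto_slope_zero_right
  refine le_of_tendsto ht ?_
  filter_upwards [h, self_mem_nhdsWithin] with s hs hpos
  rw [Set.mem_Ioi] at hpos
  rw [zero_add, smul_eq_mul, inv_mul_le_iff₀ hpos]
  linarith

/-- A Lipschitz function differentiable along a curve is differentiable, with the same derivative,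
along the tangent line. -/
theorem LipschitzWith.hasDerivAt_comp_line {E : Type*} [NormedAddCommGroup E] [NormedSpace ℝ E]
    {f : E → ℝ} {K : NNReal} (hf : LipschitzWith K f) {ξ : ℝ → E} {v : E} {t d : ℝ}
    (hξ : HasDerivAt ξ v t) (hd : HasDerivAt (fun s => f (ξ s)) d t) :
    HasDerivAt (fun s : ℝ => f (ξ t + s • v)) d 0 := by
  rw [hasDerivAt_iff_isLittleO_nhds_zero] at hξ hd ⊢
  have h : (fun s : ℝ => f (ξ t + s • v) - f (ξ (t + s))) =o[𝓝 0] fun s : ℝ => s := by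
    refine Asymptotics.IsBigO.trans_isLittleO (Asymptotics.IsBigO.of_bound K
      (Filter.Eventually.of_forall fun s => ?_)) hξ
    rw [← dist_eq_norm]
    refine (hf.dist_le_mul _ _).trans (le_of_eq ?_)
    rw [dist_comm, dist_eq_norm, sub_sub]
  refine (h.add hd).congr_left fun s => ?_
  simp only [add_zero, zero_smul, zero_add]
  ring

/-- The distances of the agents to the target form a subsolution over the extended graph. -/
theorem TargetAggregation.IsTrajectory.isSubsolution {N d : ℕ} {A : ℝ → Matrix (Fin N) (Fin N) ℝ}
    {a₀ : ℝ → Fin N → ℝ} (hA : BoundedWeights (extendedMatrix A a₀))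
    {Ω : Set (EuclideanSpace ℝ (Fin d))} (hne : Ω.Nonempty) (hcl : IsClosed Ω)
    (hconv : Convex ℝ Ω) {ω ξ : ℝ → Fin N → EuclideanSpace ℝ (Fin d)}
    (h : IsTrajectory A a₀ Ω ω ξ) :
    IsSubsolution (extendedMatrix A a₀)
      fun t o => o.elim 0 fun i => Metric.infDist (ξ t i) Ω := by
  have hac : ∀ i, ∀ T ≥ (0 : ℝ),
      AbsolutelyContinuousOnInterval (fun t => Metric.infDist (ξ t i) Ω) 0 T := fun i T hT =>
    absolutelyContinuousOnInterval_of_dist_le (ι := Unit) (f := fun _ t => ξ t i) 1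
      (fun _ => h.absolutelyContinuous i T hT) fun s t => by
        simpa using (Metric.lipschitz_infDist_pt Ω).dist_le_mul (ξ s i) (ξ t i)
  refine ⟨?_, ?_⟩
  · rintro (_ | i) T hT
    · exact absolutelyContinuousOnInterval_of_dist_le (ι := Empty) (X := ℝ) (f := fun _ _ => 0) 1
        (fun i => i.elim) fun s t => by simp
    · exact hac i T hT
  have hdiff : ∀ᵐ t, ∀ i, ∀ n : ℕ, t ∈ Set.uIcc (0 : ℝ) n →
      DifferentiableAt ℝ (fun s => Metric.infDist (ξ s i) Ω) t :=
    ae_all_iff.2 fun i => ae_all_iff.2 fun n => (hac i n n.cast_nonneg).ae_differentiableAt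
  have heq := (ae_restrict_iff' measurableSet_Ici).1 h.equation
  filter_upwards [hdiff, heq] with t hdt ht h0
  rintro (_ | i)
  · exact ⟨0, by simpa using hasDerivAt_const t (0 : ℝ), by simp [extendedMatrix]⟩
  obtain ⟨n, hn⟩ := exists_nat_ge t
  have hd := (hdt i n (by rw [Set.uIcc_of_le n.cast_nonneg]; exact ⟨h0, hn⟩)).hasDerivAt
  refine ⟨_, hd, ?_⟩
  -- On the tangent line, unlike on the curve itself, a short step is exactly a convex combination
  -- of `ξ t i` and the points that attract it, so Jensen's inequality applies.
  have hline := (Metric.lipschitz_infDist_pt Ω).hasDerivAt_comp_line (ht h0 i) hd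
  refine hline.le_of_eventually_le ?_
  have ha : ∀ o, 0 ≤ extendedMatrix A a₀ t (some i) o := fun o => hA.nonneg (some i) o t h0
  set c : Option (Fin N) → ℝ := fun o => extendedMatrix A a₀ t (some i) o with hc
  have hsmall : ∀ᶠ s in 𝓝[>] (0 : ℝ), s * ∑ o, c o ≤ 1 := by
    have : Tendsto (fun s : ℝ => s * ∑ o, c o) (𝓝[>] 0) (𝓝 0) := by
      have := (continuous_mul_const (∑ o, c o)).tendsto (0 : ℝ)
      rw [zero_mul] at this
      exact this.mono_left nhdsWithin_le_nhds
    exact (this.eventually_lt_const one_pos).mono fun s hs => hs.le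
  filter_upwards [hsmall, self_mem_nhdsWithin] with s hs hpos
  rw [Set.mem_Ioi] at hpos
  have key := infDist_add_smul_le hne hcl hconv (ξ t i) (fun o => s * c o)
    (fun o => o.elim (ω t i) (ξ t)) (fun o => mul_nonneg hpos.le (ha o))
    (by rwa [← Finset.mul_sum])
  -- The point `ω t i` is unconstrained only when its weight is zero.
  have hω : c none * (Metric.infDist (ω t i) Ω - Metric.infDist (ξ t i) Ω) =
      c none * (0 - Metric.infDist (ξ t i) Ω) := by
    rcases (ha none).eq_or_lt with h' | h'
    · simp only [hc, ← h', zero_mul]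
    · rw [Metric.infDist_zero_of_mem (h.informed i t h0 h')]
  calc Metric.infDist (ξ t i + s • (∑ j, A t i j • (ξ t j - ξ t i) +
        a₀ t i • (ω t i - ξ t i))) Ω
      = Metric.infDist (ξ t i + ∑ o : Option (Fin N),
          (s * c o) • (o.elim (ω t i) (ξ t) - ξ t i)) Ω := by
        congr 2
        simp only [Fintype.sum_option, smul_add, Finset.smul_sum, smul_smul, hc, extendedMatrix,
          Matrix.of_apply, Option.elim]
        rw [add_comm]
    _ ≤ _ := key
    _ = _ := by
        simp only [Fintype.sum_option, Option.elim, mul_assoc, hω, zero_smul, add_zero, mul_add,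
          Finset.mul_sum]
        rfl

/-! ### Uniform connectivity: exponential decay -/

section Supersolution

variable {V : Type*} [Fintype V] {A : ℝ → Matrix V V ℝ} {z : ℝ → V → ℝ}

/-- The least component of a supersolution does not decrease; in particular it stays
nonnegative. -/
theorem IsSupersolution.nonneg (hA : BoundedWeights A) (hz : IsSupersolution A z) {s t : ℝ}
    (hs : 0 ≤ s) (hst : s ≤ t) (h0 : ∀ i, 0 ≤ z s i) (i : V) : 0 ≤ z t i := by
  have hne : (Finset.univ : Finset V).Nonempty := ⟨i, Finset.mem_univ i⟩
  set m : ℝ → ℝ := fun t => Finset.univ.inf' hne (z t) with hm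
  have hle : ∀ t i, m t ≤ z t i := fun t i => Finset.inf'_le _ (Finset.mem_univ i)
  have hac : AbsolutelyContinuousOnInterval m s t := by
    refine absolutelyContinuousOnInterval_of_dist_le (f := fun i t => z t i) 1
      (fun i => absolutelyContinuousOnInterval_of_nonneg (hz.absolutelyContinuous i) hs hst)
      fun x y => ?_
    have key : ∀ x y, m x - m y ≤ 1 * ∑ i, dist (z x i) (z y i) := fun x y => by
      obtain ⟨j, -, hj⟩ := Finset.exists_mem_eq_inf' hne (z y)
      have h1 : dist (z x j) (z y j) ≤ ∑ i, dist (z x i) (z y i) :=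
        Finset.single_le_sum (f := fun i => dist (z x i) (z y i)) (fun _ _ => dist_nonneg)
          (Finset.mem_univ j)
      have h2 := hle x j
      have h3 := le_abs_self (z x j - z y j)
      rw [← Real.dist_eq] at h3
      have h4 : m y = z y j := hj
      linarith
    rw [Real.dist_eq, abs_sub_le_iff]
    refine ⟨key x y, ?_⟩
    simpa only [dist_comm] using key y x
  -- The growth lemma bounds increments from above, so it is applied to `-m`.
  have hneg : AbsolutelyContinuousOnInterval (-m) s t := hac.neg
  have hmono := hneg.sub_le_integral hst (g := fun _ => 0) (by simp) (by
    filter_upwards [hz.le_deriv] with u hu hmem f' hf'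
    have hu0 : 0 ≤ u := hs.trans hmem.1
    obtain ⟨j, -, hj⟩ := Finset.exists_mem_eq_inf' hne (z u)
    obtain ⟨z', hd, hz'⟩ := hu hu0 j
    have hm' : HasDerivAt m (-f') u := by simpa using hf'.neg
    have heq : -f' = z' := hm'.eq_of_le_of_eq hd (fun s => hle s j) hj
    have hpos : 0 ≤ ∑ k, A u j k * (z u k - z u j) := Finset.sum_nonneg fun k _ =>
      mul_nonneg (hA.nonneg j k u hu0) (by
        have h1 := hle u k
        have h2 : m u = z u j := hj
        linarith)
    linarith)
  have h1 : 0 ≤ m s := (Finset.le_inf'_iff hne _).2 fun i _ => h0 i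
  have h2 := hle t i
  simp only [Pi.neg_apply, intervalIntegral.integral_zero] at hmono
  linarith

/-- A nonnegative component of a supersolution decays at most exponentially, and it picks up a
share of a component by which it is influenced. -/
theorem IsSupersolution.exp_mul_le (hA : BoundedWeights A) (hz : IsSupersolution A z) {L : ℝ}
    (hL : ∀ i, ∀ t ≥ (0 : ℝ), ∑ j, A t i j ≤ L) {s t c : ℝ} (hs : 0 ≤ s) (hst : s ≤ t)
    (h0 : ∀ i, 0 ≤ z s i) (i j : V) (hc : 0 ≤ c) (hj : ∀ u ∈ Set.Icc s t, c ≤ z u j) :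
    Real.exp (-(L * (t - s))) * (z s i + c * ∫ u in s..t, A u i j) ≤ z t i := by
  have hexp : ∀ u, HasDerivAt (fun u => Real.exp (L * (u - s))) (Real.exp (L * (u - s)) * L) u :=
    fun u => by simpa using (((hasDerivAt_id u).sub_const s).const_mul L).exp
  have hL0 : 0 ≤ L := (Finset.sum_nonneg fun k _ => hA.nonneg i k s hs).trans (hL i s hs)
  have hexpac : AbsolutelyContinuousOnInterval (fun u => Real.exp (L * (u - s))) s t :=
    ContDiffOn.absolutelyContinuousOnInterval (by fun_prop)
  have hac := (hexpac.mul (absolutelyContinuousOnInterval_of_nonneg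
    (hz.absolutelyContinuous i) hs hst)).neg
  have hint := (hA.intervalIntegrable i j hs hst).const_mul (-c)
  -- With the integrating factor, `(exp (L (u - s)) z_i)' ≥ c a_ij`; the factor in front of `a_ij`
  -- is at least 1 and is dropped.
  have key := hac.sub_le_integral hst hint (by
    filter_upwards [hz.le_deriv] with u hu hmem f' hf'
    have hu0 : 0 ≤ u := hs.trans hmem.1
    have hzu : ∀ k, 0 ≤ z u k := hz.nonneg hA hs hmem.1 h0
    obtain ⟨z', hd, hz'⟩ := hu hu0 i
    have hf := hf'.unique ((hexp u).mul hd).neg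
    have h1 : A u i j * c ≤ ∑ k, A u i k * z u k :=
      (mul_le_mul_of_nonneg_left (hj u hmem) (hA.nonneg i j u hu0)).trans
        (Finset.single_le_sum (f := fun k => A u i k * z u k)
          (fun k _ => mul_nonneg (hA.nonneg i k u hu0) (hzu k)) (Finset.mem_univ j))
    have h2 : ∑ k, A u i k * (z u k - z u i) =
        ∑ k, A u i k * z u k - (∑ k, A u i k) * z u i := by
      simp only [mul_sub, Finset.sum_sub_distrib, Finset.sum_mul]
    have h3 : (∑ k, A u i k) * z u i ≤ L * z u i :=
      mul_le_mul_of_nonneg_right (hL i u hu0) (hzu i)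
    have h4 : 1 ≤ Real.exp (L * (u - s)) :=
      Real.one_le_exp (mul_nonneg hL0 (by linarith [hmem.1]))
    have h5 : 0 ≤ A u i j * c := mul_nonneg (hA.nonneg i j u hu0) hc
    have h6 : A u i j * c ≤ L * z u i + z' := by linarith
    have h7 : A u i j * c ≤ Real.exp (L * (u - s)) * (L * z u i + z') := by
      calc A u i j * c ≤ 1 * (L * z u i + z') := by linarith
        _ ≤ _ := mul_le_mul_of_nonneg_right h4 (h5.trans h6)
    rw [hf]
    linarith)
  rw [intervalIntegral.integral_const_mul] at key
  simp only [Pi.neg_apply, Pi.mul_apply, sub_self, mul_zero, Real.exp_zero, one_mul] at key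
  rw [Real.exp_neg, inv_mul_le_iff₀ (Real.exp_pos _)]
  linarith

/-- Over one window of uniform connectivity, the set of the nodes at which a nonnegative
supersolution is not small grows until it contains all nodes. -/
theorem IsSupersolution.card_window (hA : BoundedWeights A) (hz : IsSupersolution A z) {L : ℝ}
    (hL : ∀ i, ∀ t ≥ (0 : ℝ), ∑ j, A t i j ≤ L) {T δ η : ℝ} (hT : 0 < T) (hδ : 0 < δ)
    (hη : η = Real.exp (-(L * T)) * Real.exp (-(L * T)) * min δ 1) {r : V} {s c : ℝ}
    (hr : ∀ i, Reachable
      (graphOf (truncation δ (unionMatrix A (Set.Icc s (s + T))))) r i)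
    (hs : 0 ≤ s) (hc : 0 ≤ c) (h0 : ∀ i, 0 ≤ z s i) (hzr : c ≤ z s r) {n : ℕ}
    (hn : min n (Fintype.card V) ≤ {i | c ≤ z s i}.ncard) :
    min (n + 1) (Fintype.card V) ≤ {i | η * c ≤ z (s + T) i}.ncard := by
  have hL0 : 0 ≤ L := (Finset.sum_nonneg fun k _ => hA.nonneg r k s hs).trans (hL r s hs)
  set e := Real.exp (-(L * T))
  have he0 : 0 < e := Real.exp_pos _
  have he1 : e ≤ 1 := Real.exp_le_one_iff.2 (by simpa using mul_nonneg hL0 hT.le)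
  have hsT : s ≤ s + T := by linarith
  have hdecay : ∀ i, c ≤ z s i → ∀ u ∈ Set.Icc s (s + T), e * c ≤ z u i := fun i hi u hu => by
    have h1 := hz.exp_mul_le hA hL hs hu.1 h0 i i le_rfl
      fun v hv => hz.nonneg hA hs hv.1 h0 i
    rw [zero_mul, add_zero] at h1
    have h2 : e ≤ Real.exp (-(L * (u - s))) :=
      Real.exp_le_exp.2 (neg_le_neg (mul_le_mul_of_nonneg_left (by linarith [hu.2]) hL0))
    exact (mul_le_mul h2 hi hc (Real.exp_pos _).le).trans h1
  have hηe : η ≤ e := by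
    rw [hη]
    calc e * e * min δ 1 ≤ e * 1 * 1 := by
          gcongr
          exact min_le_right _ _
      _ = e := by ring
  have hsub : {i | c ≤ z s i} ⊆ {i | η * c ≤ z (s + T) i} := fun i hi =>
    (mul_le_mul_of_nonneg_right hηe hc).trans (hdecay i hi (s + T) ⟨hsT, le_rfl⟩)
  by_cases hall : ∀ i, c ≤ z s i
  · have : {i | η * c ≤ z (s + T) i} = Set.univ := Set.eq_univ_of_forall fun i => hsub (hall i)
    rw [this, Set.ncard_univ, Nat.card_eq_fintype_card]
    exact min_le_right _ _
  push Not at hall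
  obtain ⟨b, hb⟩ := hall
  -- A walk from the root, which lies in the set `c ≤ z`, to a node outside must leave the set along
  -- some arc.
  obtain ⟨j, i, hj, hi, hji⟩ : ∃ j i, c ≤ z s j ∧ z s i < c ∧
      (graphOf (truncation δ (unionMatrix A (Set.Icc s (s + T))))).Adj j i := by
    by_contra! hno
    refine (hb.not_ge ?_)
    have hreach := hr b
    clear hb
    unfold Reachable at hreach
    induction hreach with
    | refl => exact hzr
    | tail _ hstep ih =>
      by_contra! hlt
      rename_i p q _
      exact hno p q ih hlt hstep
  have hδi : δ ≤ ∫ u in s..(s + T), A u i j := by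
    rw [intervalIntegral.integral_of_le hsT, ← integral_Icc_eq_integral_Ioc]
    by_contra! hlt
    have : unionMatrix A (Set.Icc s (s + T)) i j < δ := hlt
    simp only [graphOf, truncation, Matrix.of_apply, if_neg this.not_ge, lt_irrefl] at hji
  have hi' : η * c ≤ z (s + T) i := by
    have h1 := hz.exp_mul_le hA hL hs hsT h0 i j (mul_nonneg he0.le hc) (hdecay j hj)
    rw [add_sub_cancel_left] at h1
    refine le_trans ?_ h1
    -- One factor `e` is the decay of `z_j` during the window, the other that of the share picked up
    -- by `z_i`.
    calc η * c = e * (e * c * min δ 1) := by rw [hη]; ring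
      _ ≤ e * (0 + e * c * ∫ u in s..(s + T), A u i j) := by
          rw [zero_add]
          gcongr
          exact (min_le_left _ _).trans hδi
      _ ≤ _ := by gcongr; exact h0 i
  have hlt : {i | c ≤ z s i}.ncard < {i | η * c ≤ z (s + T) i}.ncard :=
    Set.ncard_lt_ncard ⟨hsub, fun hsup => hi.not_ge (hsup hi')⟩ (Set.toFinite _)
  omega

/-- After as many windows of uniform connectivity as there are nodes, a nonnegative supersolution
that is constant at the root is bounded below by a fixed multiple of this constant. -/
theorem IsSupersolution.le_after_windows (hA : BoundedWeights A) (hz : IsSupersolution A z)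
    {L : ℝ} (hL : ∀ i, ∀ t ≥ (0 : ℝ), ∑ j, A t i j ≤ L) {T δ η : ℝ} (hT : 0 < T) (hδ : 0 < δ)
    (hη : η = Real.exp (-(L * T)) * Real.exp (-(L * T)) * min δ 1) (hη1 : η ≤ 1) {r : V}
    (hr : ∀ t ≥ 0, ∀ i, Reachable
      (graphOf (truncation δ (unionMatrix A (Set.Icc t (t + T))))) r i)
    {s M : ℝ} (hs : 0 ≤ s) (hM : 0 ≤ M) (h0 : ∀ i, 0 ≤ z s i)
    (hzr : ∀ t ≥ (0 : ℝ), z t r = M) (i : V) :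
    η ^ Fintype.card V * M ≤ z (s + Fintype.card V * T) i := by
  have hη0 : 0 ≤ η := by rw [hη]; positivity
  have hstep : ∀ n : ℕ,
      min n (Fintype.card V) ≤ {i | η ^ n * M ≤ z (s + n * T) i}.ncard := by
    intro n
    induction n with
    | zero => simp
    | succ n ih =>
      have hsn : 0 ≤ s + n * T := by positivity
      have h := hz.card_window hA hL hT hδ hη (hr _ hsn) hsn (by positivity)
        (hz.nonneg hA hs (by simp; positivity) h0) (by
          rw [hzr _ hsn]
          exact mul_le_of_le_one_left hM (pow_le_one₀ hη0 hη1)) ih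
      have e1 : s + n * T + T = s + ↑(n + 1) * T := by push_cast; ring
      rw [e1, ← mul_assoc, ← pow_succ'] at h
      exact h
  have h := hstep (Fintype.card V)
  rw [min_self] at h
  have huniv : {i | η ^ Fintype.card V * M ≤ z (s + Fintype.card V * T) i} = Set.univ :=
    Set.eq_of_subset_of_ncard_le (Set.subset_univ _)
      (by rwa [Set.ncard_univ, Nat.card_eq_fintype_card])
  exact Set.eq_univ_iff_forall.1 huniv i

end Supersolution

/-- A quantity that never increases and contracts over each period decays exponentially. -/
theorem le_exp_of_contraction {P ρ : ℝ} (hP : 0 < P) (hρ0 : 0 < ρ) {B : ℝ → ℝ → Prop}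
    (hmono : ∀ s t M, 0 ≤ s → s ≤ t → 0 ≤ M → B s M → B t M)
    (hcontr : ∀ s M, 0 ≤ s → 0 ≤ M → B s M → B (s + P) (ρ * M)) (hρ1 : ρ < 1) {M : ℝ}
    (hM : 0 ≤ M) (h0 : B 0 M)
    (hle : ∀ s M M', M ≤ M' → B s M → B s M') {t : ℝ} (ht : 0 ≤ t) :
    B t (ρ⁻¹ * Real.exp (-(-Real.log ρ / P) * t) * M) := by
  have hpow : ∀ n : ℕ, B (n * P) (ρ ^ n * M) := by
    intro n
    induction n with
    | zero => simpa using h0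
    | succ n ih =>
      have := hcontr _ _ (by positivity) (by positivity) ih
      rw [← mul_assoc, ← pow_succ'] at this
      convert this using 1
      push_cast; ring
  -- Only the `n` completed periods contract; the factor `ρ⁻¹` pays for the unfinished one.
  set n := ⌊t / P⌋₊
  have hn : n * P ≤ t := (le_div_iff₀ hP).1 (Nat.floor_le (by positivity))
  have hn' : t / P < n + 1 := Nat.lt_floor_add_one _
  refine hle _ _ _ ?_ (hmono _ _ _ (by positivity) hn (by positivity) (hpow n))
  refine mul_le_mul_of_nonneg_right ?_ hM
  have hlog : Real.log ρ < 0 := Real.log_neg hρ0 hρ1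
  have h1 : ρ⁻¹ * Real.exp (-(-Real.log ρ / P) * t) = Real.exp (Real.log ρ * (t / P - 1)) := by
    rw [show Real.log ρ * (t / P - 1) = -Real.log ρ + -(-Real.log ρ / P) * t by ring,
      Real.exp_add, Real.exp_neg, Real.exp_log hρ0]
  have h2 : ρ ^ n = Real.exp (Real.log ρ * n) := by
    rw [mul_comm, Real.exp_nat_mul, Real.exp_log hρ0]
  rw [h1, h2]
  exact Real.exp_le_exp.2 (mul_le_mul_of_nonpos_left (by linarith) hlog.le)

/-- Subsolutions that vanish at a root of a uniformly connected graph decay exponentially, at a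
rate that depends on the graph only. -/
theorem exists_exp_bound {V : Type*} [Fintype V] {A : ℝ → Matrix V V ℝ}
    (hA : BoundedWeights A) {T δ : ℝ} (hT : 0 < T) (hδ : 0 < δ) {r : V}
    (hr : ∀ t ≥ 0, ∀ i, Reachable
      (graphOf (truncation δ (unionMatrix A (Set.Icc t (t + T))))) r i) :
    ∃ C > (0 : ℝ), ∃ α > (0 : ℝ), ∀ y : ℝ → V → ℝ, IsSubsolution A y →
      (∀ t ≥ (0 : ℝ), y t r = 0) → ∀ M : ℝ, 0 ≤ M → (∀ i, y 0 i ≤ M) →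
      ∀ t ≥ (0 : ℝ), ∀ i, y t i ≤ C * Real.exp (-α * t) * M := by
  obtain ⟨C, hC⟩ := hA.bounded
  -- The summand 1 makes `L` positive, so that `η < 1` and hence `ρ > 0` below.
  set L := Fintype.card V * C + 1 with hLdef
  have hC0 : 0 ≤ C := (hA.nonneg r r 0 le_rfl).trans (hC r r 0 le_rfl)
  have hL : ∀ i, ∀ t ≥ (0 : ℝ), ∑ j, A t i j ≤ L := fun i t ht => by
    have := Finset.sum_le_card_nsmul Finset.univ (fun j => A t i j) C fun j _ => hC i j t ht
    rw [nsmul_eq_mul, Finset.card_univ] at this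
    linarith
  have hLpos : 0 < L := by positivity
  obtain ⟨η, hη⟩ : ∃ η, η = Real.exp (-(L * T)) * Real.exp (-(L * T)) * min δ 1 := ⟨_, rfl⟩
  have hη0 : 0 < η := by rw [hη]; positivity
  have he1 : Real.exp (-(L * T)) < 1 := Real.exp_lt_one_iff.2 (by simpa using mul_pos hLpos hT)
  have hη1 : η < 1 := by
    rw [hη]
    calc _ ≤ Real.exp (-(L * T)) * 1 * 1 := by
          gcongr
          exact min_le_right _ _
      _ < 1 := by simpa using he1
  have hcard : Fintype.card V ≠ 0 := (Fintype.card_pos_iff.2 ⟨r⟩).ne'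
  have hP : 0 < Fintype.card V * T := mul_pos (by positivity) hT
  set ρ := 1 - η ^ Fintype.card V with hρ
  have hρ0 : 0 < ρ := by linarith [pow_lt_one₀ hη0.le hη1 hcard]
  have hρ1 : ρ < 1 := by linarith [pow_pos hη0 (Fintype.card V)]
  refine ⟨ρ⁻¹, inv_pos.2 hρ0, -Real.log ρ / (Fintype.card V * T),
    div_pos (neg_pos.2 (Real.log_neg hρ0 hρ1)) hP, fun y hy hyr M hM h0 t ht => ?_⟩
  refine le_exp_of_contraction (B := fun t M => ∀ i, y t i ≤ M) hP hρ0 ?_ ?_ hρ1 hM h0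
    (fun s M M' hle h i => (h i).trans hle) ht
  · intro s t M hs hst _ h i
    have := (hy.const_sub M).nonneg hA hs hst (fun i => sub_nonneg.2 (h i)) i
    exact sub_nonneg.1 this
  · intro s M hs hM h i
    have := (hy.const_sub M).le_after_windows hA hL hT hδ hη hη1.le hr hs hM
      (fun i => sub_nonneg.2 (h i)) (fun t ht => by simp [hyr t ht]) i
    rw [hρ]
    linarith

/-! ### Weighted sums of sorted values -/

/-- The sum of the values of `v`, sorted increasingly, with the weights `w`. -/
noncomputable def sortedSum {N : ℕ} (w v : Fin N → ℝ) : ℝ := ∑ k, w k * v (Tuple.sort v k)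

/-- The rearrangement inequality. It exhibits `sortedSum w` as a maximum of linear functions, which
yields its Lipschitz bound and its derivative. -/
theorem sum_mul_comp_perm_le_sortedSum {N : ℕ} {w : Fin N → ℝ} (hw : Monotone w)
    (v : Fin N → ℝ) (σ : Equiv.Perm (Fin N)) : ∑ k, w k * v (σ k) ≤ sortedSum w v := by
  have h : Monovary w (v ∘ Tuple.sort v) := hw.monovary (Tuple.monotone_sort v)
  simpa [sortedSum] using
    h.sum_mul_comp_perm_le_sum_mul (σ := σ.trans (Tuple.sort v).symm)

theorem dist_sortedSum_le {N : ℕ} {w : Fin N → ℝ} (hw : Monotone w) (u v : Fin N → ℝ) :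
    dist (sortedSum w u) (sortedSum w v) ≤ (∑ k, |w k|) * ∑ i, dist (u i) (v i) := by
  have key : ∀ u v : Fin N → ℝ,
      sortedSum w u - sortedSum w v ≤ (∑ k, |w k|) * ∑ i, dist (u i) (v i) := fun u v => by
    refine (sub_le_sub_left (sum_mul_comp_perm_le_sortedSum hw v (Tuple.sort u)) _).trans ?_
    rw [sortedSum, ← Finset.sum_sub_distrib, Finset.sum_mul]
    refine Finset.sum_le_sum fun k _ => ?_
    rw [← mul_sub]
    refine (le_abs_self _).trans ?_
    rw [abs_mul, ← Real.dist_eq]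
    exact mul_le_mul_of_nonneg_left (Finset.single_le_sum (f := fun i => dist (u i) (v i))
      (fun _ _ => dist_nonneg) (Finset.mem_univ _)) (abs_nonneg _)
  rw [Real.dist_eq, abs_sub_le_iff]
  refine ⟨key u v, ?_⟩
  simpa only [dist_comm] using key v u

/-! ### Dissipation in cut-balanced graphs -/

/-- A linear functional that is nonpositive on the indicators of the strict superlevel sets of a
nonnegative function is nonpositive at this function. -/
theorem LinearMap.nonpos_of_superlevel {V : Type*} [Fintype V] [DecidableEq V]
    (Q : (V → ℝ) →ₗ[ℝ] ℝ) {v : V → ℝ} (hv : ∀ i, 0 ≤ v i)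
    (hQ : ∀ S : Finset V, (∀ j ∈ S, ∀ k ∉ S, v k < v j) →
      Q (fun i => if i ∈ S then 1 else 0) ≤ 0) : Q v ≤ 0 := by
  -- Layer-cake decomposition: subtracting the least positive value on the support leaves fewer
  -- positive values, and strict superlevel sets of the remainder are strict superlevel sets of `v`.
  induction hn : (Finset.univ.filter fun i => 0 < v i).card using Nat.strong_induction_on
    generalizing v with
  | _ n ih =>
    set S := Finset.univ.filter fun i => 0 < v i with hS
    have hmem : ∀ i, i ∈ S ↔ 0 < v i := fun i => by simp [hS]
    rcases S.eq_empty_or_nonempty with he | hne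
    · have : v = 0 := funext fun i => le_antisymm
        (not_lt.1 fun h => by simpa [he] using (hmem i).2 h) (hv i)
      simp [this]
    obtain ⟨m, hm, hmin⟩ := S.exists_min_image v hne
    set e : V → ℝ := fun i => if i ∈ S then 1 else 0 with he
    have hm0 : 0 < v m := (hmem m).1 hm
    have hval : ∀ i, (v - v m • e) i = if i ∈ S then v i - v m else 0 := fun i => by
      by_cases hi : i ∈ S
      · simp [he, hi]
      · have : v i = 0 := le_antisymm (not_lt.1 fun h => hi ((hmem i).2 h)) (hv i)
        simp [he, hi, this]
    have hv' : ∀ i, 0 ≤ (v - v m • e) i := fun i => by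
      rw [hval]
      split_ifs with hi
      · exact sub_nonneg.2 (hmin i hi)
      · exact le_rfl
    have h1 : Q (v - v m • e) ≤ 0 := by
      refine ih _ ?_ hv' ?_ rfl
      · rw [← hn]
        refine Finset.card_lt_card ⟨fun i hi => ?_, fun hsub => ?_⟩
        · simp only [Finset.mem_filter, Finset.mem_univ, true_and, hval] at hi
          by_contra hiS
          simp [hiS] at hi
        · have := hsub hm
          simp [hval] at this
      · intro S' hS'
        refine hQ S' fun j hj k hk => ?_
        have h := hS' j hj k hk
        have hj0 := (hv' k).trans_lt h
        rw [hval] at hj0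
        rw [hval, hval] at h
        have hjS : j ∈ S := by by_contra hjS; simp [hjS] at hj0
        by_cases hkS : k ∈ S
        · simp only [hjS, hkS, if_true] at h
          linarith
        · exact (not_lt.1 fun h => hkS ((hmem k).2 h)).trans_lt ((hmem j).1 hjS)
    have h2 : Q e ≤ 0 := hQ S fun j hj k hk =>
      (not_lt.1 fun h => hk ((hmem k).2 h)).trans_lt ((hmem j).1 hj)
    have h3 : Q v = Q (v - v m • e) + v m * Q e := by simp
    rw [h3]
    have := mul_nonpos_of_nonneg_of_nonpos hm0.le h2
    linarith

/-- The weights of the arcs that enter `S` from outside or from the target. -/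
def inflow {V : Type*} [Fintype V] [DecidableEq V] (b : Matrix V V ℝ) (b₀ : V → ℝ)
    (S : Finset V) : ℝ := ∑ j ∈ S, (∑ k ∈ Sᶜ, b j k + b₀ j)

/-- The velocity `∑ i, u_i (∑ j, b_ij (v_j - v_i) - b_i0 v_i)` as a linear functional of `v`. -/
def weightedVelocity {V : Type*} [Fintype V] (b : Matrix V V ℝ) (b₀ u : V → ℝ) :
    (V → ℝ) →ₗ[ℝ] ℝ where
  toFun v := ∑ i, u i * (∑ j, b i j * (v j - v i) - b₀ i * v i)
  map_add' v v' := by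
    rw [← Finset.sum_add_distrib]
    refine Finset.sum_congr rfl fun i _ => ?_
    simp only [Pi.add_apply, mul_sub, mul_add, Finset.sum_sub_distrib, Finset.sum_add_distrib]
    ring
  map_smul' c v := by
    rw [RingHom.id_apply, smul_eq_mul, Finset.mul_sum]
    refine Finset.sum_congr rfl fun i _ => ?_
    have : ∑ j, b i j * ((c • v) j - (c • v) i) = c * ∑ j, b i j * (v j - v i) := by
      rw [Finset.mul_sum]
      exact Finset.sum_congr rfl fun j _ => by simp only [Pi.smul_apply, smul_eq_mul]; ring
    rw [this, Pi.smul_apply, smul_eq_mul]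
    ring

section Dissipation

variable {V : Type*} [Fintype V] [DecidableEq V] {b : Matrix V V ℝ} {b₀ u : V → ℝ} {K κ : ℝ}

theorem inflow_nonneg (hb : ∀ i j, 0 ≤ b i j) (hb₀ : ∀ i, 0 ≤ b₀ i) (S : Finset V) :
    0 ≤ inflow b b₀ S :=
  Finset.sum_nonneg fun j _ => add_nonneg (Finset.sum_nonneg fun k _ => hb j k) (hb₀ j)

/-- For an indicator only arcs across the cut and arcs from the target matter. Inflow counts
negatively with weight at least `K B + κ`, outflow positively with weight at most `B`; cut balance
cancels all but `κ` times the inflow. -/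
theorem weightedVelocity_indicator_le (hb : ∀ i j, 0 ≤ b i j) (hb₀ : ∀ i, 0 ≤ b₀ i)
    (hκ : 0 ≤ κ) (hK : 0 ≤ K) {S : Finset V}
    (hcut : ∑ j ∈ S, ∑ k ∈ Sᶜ, b k j ≤ K * ∑ j ∈ S, ∑ k ∈ Sᶜ, b j k)
    (hu : ∀ i, κ ≤ u i) (huS : ∀ j ∈ S, ∀ k ∉ S, K * u k + κ ≤ u j) :
    weightedVelocity b b₀ u (fun i => if i ∈ S then 1 else 0) ≤ -(κ * inflow b b₀ S) := by
  -- `B` is the largest weight outside `S`, or 0 if `S` contains all nodes.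
  obtain ⟨B, hB0, hB1, hB2⟩ : ∃ B, 0 ≤ B ∧ (∀ k ∉ S, u k ≤ B) ∧ ∀ j ∈ S, K * B + κ ≤ u j := by
    rcases (Sᶜ).eq_empty_or_nonempty with he | hne
    · refine ⟨0, le_rfl, fun k hk => ?_, fun j _ => by simpa using hu j⟩
      simpa [he] using Finset.mem_compl.2 hk
    · obtain ⟨m, hm, hmax⟩ := (Sᶜ).exists_max_image u hne
      exact ⟨u m, hκ.trans (hu m), fun k hk => hmax k (Finset.mem_compl.2 hk),
        fun j hj => huS j hj m (Finset.mem_compl.1 hm)⟩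
  have hin : ∀ j ∈ S, u j * (∑ l, b j l * ((if l ∈ S then 1 else 0) - (if j ∈ S then 1 else 0)) -
      b₀ j * (if j ∈ S then 1 else 0)) ≤ -((K * B + κ) * (∑ k ∈ Sᶜ, b j k + b₀ j)) := by
    intro j hj
    have h1 : ∑ l, b j l * ((if l ∈ S then (1 : ℝ) else 0) - (if j ∈ S then 1 else 0)) =
        -∑ k ∈ Sᶜ, b j k := by
      rw [← Finset.sum_add_sum_compl S, Finset.sum_eq_zero, zero_add, ← Finset.sum_neg_distrib]
      · refine Finset.sum_congr rfl fun k hk => ?_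
        simp [hj, Finset.mem_compl.1 hk]
      · intro k hk
        simp [hj, hk]
    have h2 := mul_le_mul_of_nonneg_right (hB2 j hj)
      (add_nonneg (Finset.sum_nonneg fun k (_ : k ∈ Sᶜ) => hb j k) (hb₀ j))
    rw [h1, if_pos hj]
    linarith
  have hout : ∀ k ∈ Sᶜ, u k * (∑ l, b k l * ((if l ∈ S then 1 else 0) -
      (if k ∈ S then 1 else 0)) - b₀ k * (if k ∈ S then 1 else 0)) ≤ B * ∑ j ∈ S, b k j := by
    intro k hk
    have hk' := Finset.mem_compl.1 hk
    have h1 : ∑ l, b k l * ((if l ∈ S then (1 : ℝ) else 0) - (if k ∈ S then 1 else 0)) =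
        ∑ j ∈ S, b k j := by
      simp [hk']
    rw [h1, if_neg hk', mul_zero, sub_zero]
    exact mul_le_mul_of_nonneg_right (hB1 k hk') (Finset.sum_nonneg fun j _ => hb k j)
  have hsplit : weightedVelocity b b₀ u (fun i => if i ∈ S then 1 else 0) ≤
      -((K * B + κ) * inflow b b₀ S) + B * ∑ j ∈ S, ∑ k ∈ Sᶜ, b k j := by
    change ∑ i, _ ≤ _
    rw [← Finset.sum_add_sum_compl S, inflow, Finset.mul_sum, ← Finset.sum_neg_distrib,
      Finset.sum_comm, Finset.mul_sum]
    exact add_le_add (Finset.sum_le_sum hin) (Finset.sum_le_sum hout)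
  have hflow : ∑ j ∈ S, ∑ k ∈ Sᶜ, b j k ≤ inflow b b₀ S :=
    Finset.sum_le_sum fun j _ => le_add_of_nonneg_right (hb₀ j)
  have hfin : B * ∑ j ∈ S, ∑ k ∈ Sᶜ, b k j ≤ K * B * inflow b b₀ S := by
    calc _ ≤ B * (K * inflow b b₀ S) :=
          mul_le_mul_of_nonneg_left (hcut.trans (mul_le_mul_of_nonneg_left hflow hK)) hB0
      _ = _ := by ring
  linarith

/-- The weighted velocity of a nonnegative function is nonpositive if larger values have
sufficiently larger weights, and it is negative if there is a gap between the values on `S` and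
the other ones. -/
theorem weightedVelocity_le (hb : ∀ i j, 0 ≤ b i j) (hb₀ : ∀ i, 0 ≤ b₀ i)
    (hκ : 0 ≤ κ) (hK : 0 ≤ K)
    (hcut : ∀ S : Finset V, ∑ j ∈ S, ∑ k ∈ Sᶜ, b k j ≤ K * ∑ j ∈ S, ∑ k ∈ Sᶜ, b j k)
    {v : V → ℝ} (hv : ∀ i, 0 ≤ v i)
    (hu : ∀ i, κ ≤ u i) (huv : ∀ j k, v k < v j → K * u k + κ ≤ u j)
    {S : Finset V} {g : ℝ} (hg : 0 ≤ g) (hgS : ∀ j ∈ S, g ≤ v j)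
    (hgap : ∀ j ∈ S, ∀ k ∉ S, v k + g ≤ v j) :
    weightedVelocity b b₀ u v ≤ -(κ * g * inflow b b₀ S) := by
  set e : V → ℝ := fun i => if i ∈ S then 1 else 0 with he
  -- Thanks to the gap, lowering the values on `S` by `g` creates no new strict inequality, so the
  -- weights remain compatible with the order.
  have h1 : weightedVelocity b b₀ u (v - g • e) ≤ 0 := by
    refine LinearMap.nonpos_of_superlevel _ (fun i => ?_) fun S' hS' => ?_
    · by_cases hi : i ∈ S
      · simpa [he, hi] using hgS i hi
      · simpa [he, hi] using hv i
    · refine (weightedVelocity_indicator_le hb hb₀ hκ hK (hcut S') hu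
        fun j hj k hk => huv j k ?_).trans
        (neg_nonpos.2 (mul_nonneg hκ (inflow_nonneg hb hb₀ S')))
      have h := hS' j hj k hk
      by_cases hjS : j ∈ S <;> by_cases hkS : k ∈ S <;> simp [he, hjS, hkS] at h
      · exact h
      · linarith
      · linarith [hgap k hkS j hjS]
      · exact h
  have h2 : weightedVelocity b b₀ u v =
      weightedVelocity b b₀ u (v - g • e) + g * weightedVelocity b b₀ u e := by simp
  rw [h2]
  -- A zero gap does not make the values on `S` strictly larger, but then the indicator term
  -- vanishes.
  rcases hg.eq_or_lt with h0 | h0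
  · rw [← h0] at h1 ⊢
    simpa using h1
  · have h3 := mul_le_mul_of_nonneg_left (weightedVelocity_indicator_le hb hb₀ hκ hK (hcut S) hu
      fun j hj k hk => huv j k (by linarith [hgap j hj k hk])) hg
    linarith

end Dissipation

/-! ### Convergence over cut-balanced graphs -/

/-- Weights, increasing by more than the factor `K`, for which the weighted sums of the sorted
values are Lyapunov functions with the dissipation rate `κ`. -/
structure IsLyapunovWeight {N : ℕ} (K κ : ℝ) (w : Fin N → ℝ) : Prop where
  le : ∀ k, κ ≤ w k
  mul_add_le : ∀ l k, l < k → K * w l + κ ≤ w k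

theorem IsLyapunovWeight.monotone {N : ℕ} {K κ : ℝ} (hK : 1 ≤ K) (hκ : 0 ≤ κ) {w : Fin N → ℝ}
    (hw : IsLyapunovWeight K κ w) : Monotone w := by
  intro l k hlk
  rcases hlk.eq_or_lt with rfl | h
  · exact le_rfl
  · have h1 := hw.mul_add_le l k h
    have h2 := mul_le_mul_of_nonneg_right hK (hκ.trans (hw.le l))
    linarith

/-- Of the factor `2K`, one `K` serves the cut balance; the surplus `K (2K)^l ≥ 1` is the
dissipation rate. -/
theorem isLyapunovWeight_pow {N : ℕ} {K : ℝ} (hK : 1 ≤ K) :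
    IsLyapunovWeight K 1 fun k : Fin N => (2 * K) ^ (k : ℕ) where
  le k := one_le_pow₀ (by linarith)
  mul_add_le l k hlk := by
    have h1 : (2 * K) ^ ((l : ℕ) + 1) ≤ (2 * K) ^ (k : ℕ) :=
      pow_le_pow_right₀ (by linarith) hlk
    have h2 : 1 ≤ (2 * K) ^ (l : ℕ) := one_le_pow₀ (by linarith)
    rw [pow_succ'] at h1
    nlinarith

/-- The surplus in the factor `2K` can instead absorb an increasing step in the weights. Differences
of such weights isolate single sorted values. -/
theorem isLyapunovWeight_pow_add {N : ℕ} {K : ℝ} (hK : 1 ≤ K) (p : Fin N → Prop)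
    [DecidablePred p] (hp : ∀ l k, l < k → p l → p k) :
    IsLyapunovWeight K 0 fun k : Fin N => (2 * K) ^ (k : ℕ) + if p k then 1 else 0 where
  le k := by positivity
  mul_add_le l k hlk := by
    have h1 : (2 * K) ^ ((l : ℕ) + 1) ≤ (2 * K) ^ (k : ℕ) :=
      pow_le_pow_right₀ (by linarith) hlk
    have h2 : 1 ≤ (2 * K) ^ (l : ℕ) := one_le_pow₀ (by linarith)
    rw [pow_succ'] at h1
    by_cases hl : p l
    · rw [if_pos hl, if_pos (hp l k hlk hl)]
      nlinarith
    · rw [if_neg hl]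
      have : (0 : ℝ) ≤ if p k then 1 else 0 := by positivity
      nlinarith

section CutBalanced

variable {N : ℕ} {A : ℝ → Matrix (Fin N) (Fin N) ℝ} {a₀ : ℝ → Fin N → ℝ}
  {y : ℝ → Fin N → ℝ} {K κ : ℝ}

theorem intervalIntegrable_inflow (hA : BoundedWeights (extendedMatrix A a₀)) (S : Finset (Fin N))
    {s t : ℝ} (hs : 0 ≤ s) (hst : s ≤ t) :
    IntervalIntegrable (fun u => inflow (A u) (a₀ u) S) volume s t := by
  have heq : (fun u => inflow (A u) (a₀ u) S) =
      ∑ j ∈ S, fun u => ∑ k ∈ Sᶜ, A u j k + a₀ u j := by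
    ext u
    rw [Finset.sum_apply, inflow]
  rw [heq]
  have h := IntervalIntegrable.sum S (f := fun j u => ∑ k ∈ Sᶜ, A u j k + a₀ u j)
    (μ := volume) (a := s) (b := t) fun j _ => by
      have h1 := IntervalIntegrable.sum Sᶜ (f := fun k u => A u j k)
        (μ := volume) (a := s) (b := t) fun k _ => hA.intervalIntegrable (some j) (some k) hs hst
      have h2 := h1.add (hA.intervalIntegrable (some j) none hs hst)
      convert h2 using 2 with u
      simp [extendedMatrix]
  exact h

/-- The weighted sum of the sorted values of a nonnegative subsolution does not increase, and
decreases at least by the integral of the inflow of a set that stays separated. -/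
theorem sortedSum_add_integral_le (hA : BoundedWeights (extendedMatrix A a₀)) (hK : 1 ≤ K)
    (hcut : ∀ S : Finset (Fin N), ∀ t ≥ (0 : ℝ),
      ∑ j ∈ S, ∑ k ∈ Sᶜ, A t k j ≤ K * ∑ j ∈ S, ∑ k ∈ Sᶜ, A t j k)
    (hy : IsSubsolution (extendedMatrix A a₀) fun t o => o.elim 0 (y t))
    (hy0 : ∀ t i, 0 ≤ y t i) (hκ : 0 ≤ κ) {w : Fin N → ℝ} (hw : IsLyapunovWeight K κ w)
    {S : Finset (Fin N)} {g : ℝ} (hg : 0 ≤ g) {s t : ℝ} (hs : 0 ≤ s) (hst : s ≤ t)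
    (hgS : ∀ u ∈ Set.Icc s t, ∀ j ∈ S, g ≤ y u j)
    (hgap : ∀ u ∈ Set.Icc s t, ∀ j ∈ S, ∀ k ∉ S, y u k + g ≤ y u j) :
    sortedSum w (y t) + κ * g * ∫ u in s..t, inflow (A u) (a₀ u) S ≤ sortedSum w (y s) := by
  have hmono := hw.monotone hK hκ
  have hac : AbsolutelyContinuousOnInterval (fun t => sortedSum w (y t)) s t :=
    absolutelyContinuousOnInterval_of_dist_le (f := fun i t => y t i) (∑ k, |w k|)
      (fun i => absolutelyContinuousOnInterval_of_nonneg (hy.absolutelyContinuous (some i)) hs hst)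
      fun x z => dist_sortedSum_le hmono _ _
  have key := hac.sub_le_integral hst
    ((intervalIntegrable_inflow hA S hs hst).const_mul (-(κ * g))) (by
    filter_upwards [hy.deriv_le] with u hu hmem f' hf'
    have hu0 : 0 ≤ u := hs.trans hmem.1
    choose d hd hle using fun i => hu hu0 (some i)
    simp only [Option.elim] at hd
    set σ := Tuple.sort (y u) with hσ
    -- The order `σ` is frozen at time `u`; this sum touches the sorted sum from below there.
    have hlin : HasDerivAt (fun s => ∑ k, w k * y s (σ k)) (∑ k, w k * d (σ k)) u :=
      HasDerivAt.fun_sum fun k _ => (hd (σ k)).const_mul (w k)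
    have heq : f' = ∑ k, w k * d (σ k) := (hlin.eq_of_le_of_eq hf'
      (fun s => sum_mul_comp_perm_le_sortedSum hmono (y s) σ) rfl).symm
    have h1 : f' ≤ weightedVelocity (A u) (a₀ u) (w ∘ σ.symm) (y u) := by
      rw [heq, ← Equiv.sum_comp σ.symm]
      refine Finset.sum_le_sum fun i _ => ?_
      simp only [Equiv.apply_symm_apply, Function.comp_apply]
      refine mul_le_mul_of_nonneg_left ?_ (hκ.trans (hw.le _))
      refine (hle i).trans (le_of_eq ?_)
      simp only [Fintype.sum_option, extendedMatrix, Matrix.of_apply, Option.elim]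
      ring
    refine h1.trans ((weightedVelocity_le (κ := κ) (K := K)
      (fun i j => hA.nonneg (some i) (some j) u hu0)
      (fun i => hA.nonneg (some i) none u hu0) hκ (by linarith) (fun S => hcut S u hu0) (hy0 u)
      (fun i => hw.le _) (fun j k hjk => hw.mul_add_le _ _ ?_) hg (hgS u hmem)
      (hgap u hmem)).trans (le_of_eq (neg_mul _ _).symm))
    by_contra! hle
    have := Tuple.monotone_sort (y u) hle
    simp only [← hσ, Function.comp_apply, Equiv.apply_symm_apply] at this
    linarith)
  rw [intervalIntegral.integral_const_mul] at key
  linarith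

/-- The sorted values of a nonnegative subsolution over a cut-balanced graph converge. -/
theorem exists_tendsto_sorted (hA : BoundedWeights (extendedMatrix A a₀)) (hK : 1 ≤ K)
    (hcut : ∀ S : Finset (Fin N), ∀ t ≥ (0 : ℝ),
      ∑ j ∈ S, ∑ k ∈ Sᶜ, A t k j ≤ K * ∑ j ∈ S, ∑ k ∈ Sᶜ, A t j k)
    (hy : IsSubsolution (extendedMatrix A a₀) fun t o => o.elim 0 (y t))
    (hy0 : ∀ t i, 0 ≤ y t i) (m : Fin N) :
    ∃ l, Tendsto (fun t => y t (Tuple.sort (y t) m)) atTop (𝓝 l) := by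
  have hconv : ∀ w : Fin N → ℝ, IsLyapunovWeight K 0 w →
      ∃ l, Tendsto (fun t => sortedSum w (y t)) atTop (𝓝 l) := fun w hw => by
    -- The empty set with gap 0 leaves plain monotonicity; `max t 0` extends it from `[0, ∞)` to the
    -- whole line.
    have hanti : Antitone fun t => sortedSum w (y (max t 0)) := fun s t hst => by
      simpa using sortedSum_add_integral_le hA hK hcut hy hy0 le_rfl hw (S := ∅) (g := 0) le_rfl
        (le_max_right s 0) (max_le_max_right 0 hst) (by simp) (by simp)
    have hbdd : BddBelow (Set.range fun t => sortedSum w (y (max t 0))) :=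
      ⟨0, by
        rintro _ ⟨t, rfl⟩
        exact Finset.sum_nonneg fun k _ => mul_nonneg (hw.le k) (hy0 _ _)⟩
    refine ⟨_, (tendsto_atTop_ciInf hanti hbdd).congr' ?_⟩
    filter_upwards [eventually_ge_atTop 0] with t ht
    rw [max_eq_left ht]
  -- The steps at `m ≤ k` and `m < k` differ only at `k = m`, so the two Lyapunov functions differ
  -- by the sorted value number `m`.
  obtain ⟨l₁, h₁⟩ := hconv _ (isLyapunovWeight_pow_add hK (fun k => m ≤ k)
    fun l k hlk h => h.trans hlk.le)
  obtain ⟨l₂, h₂⟩ := hconv _ (isLyapunovWeight_pow_add hK (fun k => m < k)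
    fun l k hlk h => h.trans hlk)
  refine ⟨l₁ - l₂, (h₁.sub h₂).congr fun t => ?_⟩
  rw [sortedSum, sortedSum, ← Finset.sum_sub_distrib, Finset.sum_eq_single m]
  · simp only [le_refl, if_true, lt_irrefl, if_false]
    ring
  · intro k _ hk
    by_cases h : m ≤ k
    · simp [h, lt_of_le_of_ne h hk.symm]
    · have h' : ¬m < k := fun h' => h h'.le
      simp [h, h']
  · simp

end CutBalanced

theorem totalIntegral_ne_top {f : ℝ → ℝ} {t₀ B : ℝ} (ht₀ : 0 ≤ t₀) (hf : ∀ t ≥ (0 : ℝ), 0 ≤ f t)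
    (hint : ∀ s t, 0 ≤ s → s ≤ t → IntervalIntegrable f volume s t)
    (hB : ∀ t ≥ t₀, ∫ u in t₀..t, f u ≤ B) : totalIntegral f ≠ ⊤ := by
  have h1 : IntegrableOn f (Set.Ioi t₀) := by
    refine integrableOn_Ioi_of_intervalIntegral_norm_bounded B t₀ (l := atTop)
      (b := fun n : ℕ => t₀ + n) (fun n => ?_) (tendsto_atTop_add_const_left _ _ tendsto_natCast_atTop_atTop)
      (Filter.Eventually.of_forall fun n => ?_)
    · exact (intervalIntegrable_iff_integrableOn_Ioc_of_le (by simp)).1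
        (hint t₀ (t₀ + n) ht₀ (by simp))
    · refine le_of_eq_of_le (intervalIntegral.integral_congr fun u hu => ?_)
        (hB (t₀ + n) (by simp))
      rw [Set.uIcc_of_le (by simp)] at hu
      exact Real.norm_of_nonneg (hf u (ht₀.trans hu.1))
  have h2 : IntegrableOn f (Set.Icc 0 t₀) :=
    (intervalIntegrable_iff_integrableOn_Icc_of_le ht₀).1 (hint 0 t₀ le_rfl ht₀)
  have h3 := h2.union h1
  rw [Set.Icc_union_Ioi_eq_Ici ht₀] at h3
  exact h3.lintegral_lt_top.ne

/-- A continuous function that avoids the interval `[a, b]` stays on one side of it. -/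
theorem lt_iff_of_avoids {f : ℝ → ℝ} {a b s t : ℝ} (hab : a < b)
    (hf : ContinuousOn f (Set.Icc s t)) (hst : s ≤ t)
    (h : ∀ u ∈ Set.Icc s t, f u < a ∨ b < f u) : b < f t ↔ b < f s := by
  have hs := h s ⟨le_rfl, hst⟩
  have ht := h t ⟨hst, le_rfl⟩
  constructor <;> intro h'
  · by_contra hn
    have hlt : f s < a := hs.resolve_right hn
    obtain ⟨u, hu, hfu⟩ := intermediate_value_Icc hst hf ⟨hlt.le, (hab.trans h').le⟩
    rcases h u hu with h1 | h1 <;> linarith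
  · by_contra hn
    have hlt : f t < a := ht.resolve_right hn
    obtain ⟨u, hu, hfu⟩ := intermediate_value_Icc' hst hf ⟨hlt.le, (hab.trans h').le⟩
    rcases h u hu with h1 | h1 <;> linarith

section CutBalanced

variable {N : ℕ} {A : ℝ → Matrix (Fin N) (Fin N) ℝ} {a₀ : ℝ → Fin N → ℝ}
  {y : ℝ → Fin N → ℝ}

/-- No nonempty set of agents is eventually separated from the others and from the target. -/
theorem not_eventually_separated (hA : BoundedWeights (extendedMatrix A a₀))
    (hcut : CutBalanced A) (hisc : InfinitelyStronglyConnected A)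
    (ha₀ : ∑ i, totalIntegral (fun t => a₀ t i) = ⊤)
    (hy : IsSubsolution (extendedMatrix A a₀) fun t o => o.elim 0 (y t))
    (hy0 : ∀ t i, 0 ≤ y t i) {S : Finset (Fin N)} (hS : S.Nonempty) {g : ℝ} (hg : 0 < g)
    {t₀ : ℝ} (ht₀ : 0 ≤ t₀) (hgS : ∀ u ≥ t₀, ∀ j ∈ S, g ≤ y u j)
    (hgap : ∀ u ≥ t₀, ∀ j ∈ S, ∀ k ∉ S, y u k + g ≤ y u j) : False := by
  obtain ⟨K, hK, hcutK⟩ := hcut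
  have hK0 : 0 < K := by linarith
  have hcut' : ∀ S : Finset (Fin N), ∀ t ≥ (0 : ℝ),
      ∑ j ∈ S, ∑ k ∈ Sᶜ, A t k j ≤ K * ∑ j ∈ S, ∑ k ∈ Sᶜ, A t j k := fun S t ht =>
    (inv_mul_le_iff₀ hK0).1 (hcutK S t ht).1
  have hw := isLyapunovWeight_pow (N := N) hK
  set w : Fin N → ℝ := fun k => (2 * K) ^ (k : ℕ)
  have hbound : ∀ t ≥ t₀, ∫ u in t₀..t, inflow (A u) (a₀ u) S ≤ sortedSum w (y t₀) / g := by
    intro t ht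
    have h := sortedSum_add_integral_le hA hK hcut' hy hy0 zero_le_one hw hg.le ht₀ ht
      (fun u hu => hgS u hu.1) (fun u hu => hgap u hu.1)
    have h0 : 0 ≤ sortedSum w (y t) :=
      Finset.sum_nonneg fun k _ => mul_nonneg (zero_le_one.trans (hw.le k)) (hy0 _ _)
    rw [le_div_iff₀ hg]
    linarith
  have hn : ∀ i j, ∀ t ≥ (0 : ℝ), 0 ≤ A t i j := fun i j => hA.nonneg (some i) (some j)
  have hn₀ : ∀ i, ∀ t ≥ (0 : ℝ), 0 ≤ a₀ t i := fun i => hA.nonneg (some i) none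
  have hfin : ∀ i : Fin N, ∀ o : Option (Fin N),
      (∀ t ≥ (0 : ℝ), extendedMatrix A a₀ t (some i) o ≤ inflow (A t) (a₀ t) S) →
      totalIntegral (fun t => extendedMatrix A a₀ t (some i) o) ≠ ⊤ := by
    intro i o hle
    refine totalIntegral_ne_top (B := sortedSum w (y t₀) / g) ht₀ (hA.nonneg (some i) o)
      (fun s t hs hst => hA.intervalIntegrable (some i) o hs hst) fun t ht => ?_
    exact (intervalIntegral.integral_mono_on ht (hA.intervalIntegrable (some i) o ht₀ ht)
      (intervalIntegrable_inflow hA S ht₀ ht) fun u hu => hle u (ht₀.trans hu.1)).trans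
      (hbound t ht)
  have hterm : ∀ t ≥ (0 : ℝ), ∀ j ∈ S,
      ∑ k ∈ Sᶜ, A t j k + a₀ t j ≤ inflow (A t) (a₀ t) S := fun t ht j hj =>
    Finset.single_le_sum (f := fun j => ∑ k ∈ Sᶜ, A t j k + a₀ t j)
      (fun j _ => add_nonneg (Finset.sum_nonneg fun k _ => hn j k t ht) (hn₀ j t ht)) hj
  -- If `S` contains all agents, its inflow comes from the target alone; otherwise some arc of
  -- infinite total weight enters `S` from an agent outside.
  by_cases huniv : S = Finset.univ
  · refine ENNReal.sum_ne_top.2 (fun i _ => hfin i none fun t ht => ?_) ha₀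
    have h1 := hterm t ht i (huniv ▸ Finset.mem_univ i)
    have h2 : 0 ≤ ∑ k ∈ Sᶜ, A t i k := Finset.sum_nonneg fun k _ => hn i k t ht
    change a₀ t i ≤ _
    linarith
  · obtain ⟨k, hk⟩ : ∃ k, k ∉ S := by
      by_contra! h
      exact huniv (Finset.eq_univ_of_forall h)
    obtain ⟨j, hj⟩ := hS
    obtain ⟨p, q, hp, hq, hpq⟩ : ∃ p q, p ∉ S ∧ q ∈ S ∧
        totalIntegral (fun t => A t q p) = ⊤ := by
      by_contra! hno
      have hreach := hisc k j
      unfold Reachable at hreach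
      have : j ∉ S := by
        clear hj
        induction hreach with
        | refl => exact hk
        | tail _ hstep ih => exact fun hmem => hno _ _ ih hmem hstep
      exact this hj
    refine hfin q (some p) (fun t ht => ?_) hpq
    have h1 := hterm t ht q hq
    have h2 : A t q p ≤ ∑ k ∈ Sᶜ, A t q k :=
      Finset.single_le_sum (f := fun k => A t q k) (fun k _ => hn q k t ht)
        (Finset.mem_compl.2 hp)
    have h3 := hn₀ q t ht
    change A t q p ≤ _
    linarith

/-- Nonnegative subsolutions over a cut-balanced, infinitely strongly connected graph that is
influenced by the target infinitely much tend to zero. -/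
theorem tendsto_zero_of_cutBalanced (hA : BoundedWeights (extendedMatrix A a₀))
    (hcut : CutBalanced A) (hisc : InfinitelyStronglyConnected A)
    (ha₀ : ∑ i, totalIntegral (fun t => a₀ t i) = ⊤)
    (hy : IsSubsolution (extendedMatrix A a₀) fun t o => o.elim 0 (y t))
    (hy0 : ∀ t i, 0 ≤ y t i) (i : Fin N) : Tendsto (fun t => y t i) atTop (𝓝 0) := by
  have hlim : ∀ m, ∃ l, Tendsto (fun t => y t (Tuple.sort (y t) m)) atTop (𝓝 l) := by
    obtain ⟨K, hK, hcutK⟩ := hcut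
    exact exists_tendsto_sorted hA hK
      (fun S t ht => (inv_mul_le_iff₀ (by linarith)).1 (hcutK S t ht).1) hy hy0
  choose l hl using hlim
  have hl0 : ∀ k, 0 ≤ l k := fun k => ge_of_tendsto' (hl k) fun t => hy0 _ _
  have hzero : ∀ k, l k = 0 := by
    by_contra! hex
    obtain ⟨k₁, hk₁⟩ := hex
    -- With `l m` the least positive limit, eventually no value lies between `l m / 3` and `2 l m /
    -- 3`. By continuity no agent crosses this gap, so the upper group is constant in time.
    obtain ⟨m, hm, hmin⟩ := (Finset.univ.filter fun k => 0 < l k).exists_min_image l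
      ⟨k₁, by simpa using lt_of_le_of_ne (hl0 k₁) hk₁.symm⟩
    simp only [Finset.mem_filter, Finset.mem_univ, true_and] at hm hmin
    have hev : ∀ᶠ t in atTop, ∀ k, y t (Tuple.sort (y t) k) < l m / 3 ∨
        2 * l m / 3 < y t (Tuple.sort (y t) k) := by
      refine eventually_all.2 fun k => ?_
      rcases (hl0 k).eq_or_lt with h | h
      · exact ((hl k).eventually_lt_const (by linarith)).mono fun t => Or.inl
      · exact ((hl k).eventually_const_lt (by linarith [hmin k h])).mono fun t => Or.inr
    have hpos : ∀ᶠ t in atTop, 2 * l m / 3 < y t (Tuple.sort (y t) m) :=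
      (hl m).eventually_const_lt (by linarith)
    obtain ⟨t₀, ht₀⟩ := eventually_atTop.1 ((hev.and hpos).and (eventually_ge_atTop 0))
    have ht₀0 : 0 ≤ t₀ := (ht₀ t₀ le_rfl).2
    have hsep : ∀ t ≥ t₀, ∀ i, y t i < l m / 3 ∨ 2 * l m / 3 < y t i := fun t ht i => by
      simpa using (ht₀ t ht).1.1 ((Tuple.sort (y t)).symm i)
    have hside : ∀ t ≥ t₀, ∀ i, 2 * l m / 3 < y t i ↔ 2 * l m / 3 < y t₀ i := fun t ht i => by
      have hcont := (absolutelyContinuousOnInterval_of_nonneg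
        (hy.absolutelyContinuous (some i)) ht₀0 ht).continuousOn
      rw [Set.uIcc_of_le ht] at hcont
      exact lt_iff_of_avoids (by linarith) hcont ht fun u hu => hsep u hu.1 i
    refine not_eventually_separated hA hcut hisc ha₀ hy hy0
      (S := Finset.univ.filter fun i => 2 * l m / 3 < y t₀ i) (g := l m / 3)
      ⟨Tuple.sort (y t₀) m, by simpa using (ht₀ t₀ le_rfl).1.2⟩ (by linarith) ht₀0 ?_ ?_
    · intro u hu j hj
      simp only [Finset.mem_filter, Finset.mem_univ, true_and, ← hside u hu] at hj
      linarith
    · intro u hu j hj k hk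
      simp only [Finset.mem_filter, Finset.mem_univ, true_and, ← hside u hu] at hj hk
      have := (hsep u hu k).resolve_right hk
      linarith
  have hsum : Tendsto (fun t => ∑ k, y t (Tuple.sort (y t) k)) atTop (𝓝 0) := by
    simpa [hzero] using tendsto_finsetSum Finset.univ fun k _ => hl k
  -- Sorting does not change the sum, and the sum dominates each nonnegative value.
  refine squeeze_zero (fun t => hy0 t i) (fun t => ?_) hsum
  rw [Equiv.sum_comp (Tuple.sort (y t)) (y t)]
  exact Finset.single_le_sum (fun k _ => hy0 t k) (Finset.mem_univ i)

end CutBalanced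

/-! ### The main theorem -/

/-- The root of the extended graph over any window is the target, since no arc enters the
target. -/
theorem reachable_target {N : ℕ} {A : ℝ → Matrix (Fin N) (Fin N) ℝ} {a₀ : ℝ → Fin N → ℝ}
    {δ : ℝ} (hδ : 0 < δ) {Δ : Set ℝ}
    (h : QuasiStronglyDeltaConnected δ (unionMatrix (extendedMatrix A a₀) Δ))
    (o : Option (Fin N)) :
    Reachable (graphOf (truncation δ (unionMatrix (extendedMatrix A a₀) Δ))) none o := by
  obtain ⟨r, hr⟩ := h
  have hnone : r = none := by
    rcases (hr none).cases_tail with h | ⟨p, -, hp⟩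
    · exact h.symm
    · simp [graphOf, truncation, unionMatrix, extendedMatrix, hδ.not_ge] at hp
  exact hnone ▸ hr o

/-- Under uniform quasi-strong connectivity the distances to the target decay exponentially. -/
theorem exists_halfSqDist_exp_bound {N : ℕ} {A : ℝ → Matrix (Fin N) (Fin N) ℝ}
    {a₀ : ℝ → Fin N → ℝ} (hA : BoundedWeights (extendedMatrix A a₀))
    (h : UniformlyQuasiStronglyConnected (extendedMatrix A a₀)) :
    ∃ C > (0 : ℝ), ∃ α > (0 : ℝ),
      ∀ (d : ℕ) (Ω : Set (EuclideanSpace ℝ (Fin d))), Ω.Nonempty → IsClosed Ω → Convex ℝ Ω →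
        ∀ ω ξ : ℝ → Fin N → EuclideanSpace ℝ (Fin d), IsTrajectory A a₀ Ω ω ξ →
          ∀ i, ∀ t ≥ (0 : ℝ), halfSqDist Ω (ξ t i) ≤
            C * Real.exp (-α * t) * ⨆ j, halfSqDist Ω (ξ 0 j) := by
  obtain ⟨T, hT, δ, hδ, hconn⟩ := h
  obtain ⟨C, hC, α, hα, hbound⟩ := exists_exp_bound hA hT hδ (r := none)
    fun t ht => reachable_target hδ (hconn t ht)
  -- The bound is proved for distances and then squared; the initial distances are at most `√(2 *
  -- x)`.
  refine ⟨C ^ 2, by positivity, 2 * α, by positivity, ?_⟩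
  intro d Ω hne hcl hconv ω ξ hξ i t ht
  set x := ⨆ j, halfSqDist Ω (ξ 0 j)
  have hle : ∀ j, halfSqDist Ω (ξ 0 j) ≤ x := le_ciSup (Set.finite_range _).bddAbove
  have hx0 : 0 ≤ x := le_trans (by unfold halfSqDist; positivity) (hle i)
  have hb := hbound _ (hξ.isSubsolution hA hne hcl hconv) (fun _ _ => rfl) (√(2 * x))
    (Real.sqrt_nonneg _) (by
      rintro (_ | j)
      · exact Real.sqrt_nonneg _
      · refine Real.le_sqrt_of_sq_le ?_
        have := hle j
        unfold halfSqDist at this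
        simp only [Option.elim]
        linarith) t ht (some i)
  simp only [Option.elim] at hb
  have hsq := pow_le_pow_left₀ Metric.infDist_nonneg hb 2
  rw [mul_pow, mul_pow, Real.sq_sqrt (by positivity), ← Real.exp_nat_mul] at hsq
  rw [show -(2 * α) * t = ((2 : ℕ) : ℝ) * (-α * t) by push_cast; ring]
  generalize Real.exp (((2 : ℕ) : ℝ) * (-α * t)) = E at hsq ⊢
  unfold halfSqDist
  linarith

theorem mainTheorem5 (N : ℕ) (A : ℝ → Matrix (Fin N) (Fin N) ℝ) (a₀ : ℝ → Fin N → ℝ)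
    (hA : BoundedWeights (extendedMatrix A a₀)) :
    (UniformlyQuasiStronglyConnected (extendedMatrix A a₀) ∨
        (CutBalanced A ∧ InfinitelyStronglyConnected A ∧
          ∑ i, totalIntegral (fun t => a₀ t i) = ⊤) →
      ∀ (d : ℕ) (Ω : Set (EuclideanSpace ℝ (Fin d))), Ω.Nonempty → IsClosed Ω → Convex ℝ Ω →
        ∀ ω ξ : ℝ → Fin N → EuclideanSpace ℝ (Fin d), IsTrajectory A a₀ Ω ω ξ →
          ∀ i, Tendsto (fun t => halfSqDist Ω (ξ t i)) atTop (𝓝 0)) ∧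
    (UniformlyQuasiStronglyConnected (extendedMatrix A a₀) →
      ∃ C > (0 : ℝ), ∃ α > (0 : ℝ),
        ∀ (d : ℕ) (Ω : Set (EuclideanSpace ℝ (Fin d))), Ω.Nonempty → IsClosed Ω → Convex ℝ Ω →
          ∀ ω ξ : ℝ → Fin N → EuclideanSpace ℝ (Fin d), IsTrajectory A a₀ Ω ω ξ →
            ∀ i, ∀ t ≥ (0 : ℝ),
              halfSqDist Ω (ξ t i) ≤
                C * Real.exp (-α * t) * ⨆ j, halfSqDist Ω (ξ 0 j)) := by
  refine ⟨fun h d Ω hne hcl hconv ω ξ hξ i => ?_, exists_halfSqDist_exp_bound hA⟩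
  rcases h with h | ⟨hcut, hisc, ha₀⟩
  · obtain ⟨C, -, α, hα, hbound⟩ := exists_halfSqDist_exp_bound hA h
    have hexp : Tendsto (fun t => C * Real.exp (-α * t) * ⨆ j, halfSqDist Ω (ξ 0 j)) atTop
        (𝓝 0) := by
      have h1 : Tendsto (fun t => Real.exp (-α * t)) atTop (𝓝 0) :=
        Real.tendsto_exp_atBot.comp (tendsto_id.const_mul_atTop_of_neg (neg_neg_of_pos hα))
      simpa using (h1.const_mul C).mul_const (⨆ j, halfSqDist Ω (ξ 0 j))
    refine tendsto_of_tendsto_of_tendsto_of_le_of_le' tendsto_const_nhds hexp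
      (Filter.Eventually.of_forall fun t => by unfold halfSqDist; positivity) ?_
    filter_upwards [eventually_ge_atTop 0] with t ht
    exact hbound d Ω hne hcl hconv ω ξ hξ i t ht
  · have hlim := tendsto_zero_of_cutBalanced (y := fun t i => Metric.infDist (ξ t i) Ω) hA hcut
      hisc ha₀ (hξ.isSubsolution hA hne hcl hconv) (fun _ _ => Metric.infDist_nonneg) i
    simpa only [halfSqDist, ne_eq, OfNat.ofNat_ne_zero, not_false_eq_true, zero_pow, mul_zero]
      using (hlim.pow 2).const_mul (1 / 2)
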